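/- Let $n\ge k$ be integers such that $4\le k\le\sqrt{2n-1}+1$. Let $g(n,k)$ be the least integer $m\ge k$ such that each sequence of length $m$ in $\mathbb{Z}_n=\mathbb{Z}/n\mathbb{Z}$ with at least $k$ distinct terms contains an $n$-term zero sum, that is, has $n$ terms (at $n$ different positions) whose sum is zero in $\mathbb{Z}_n$. Then $g(n,k)$ exists and $$g(n,k)=2n-1-\left\lfloor\left(\frac{k-1}{2}\right)^2\right\rfloor .$$ -/

import Mathlib

/-- The finite sequence `a` in `ℤ/nℤ` contains an `n`-term zero sum: some `n` of its terms
(chosen at `n` different positions) add up to zero. -/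
def HasNTermZeroSum (n : ℕ) {m : ℕ} (a : Fin m → ZMod n) : Prop :=
  ∃ I : Finset (Fin m), I.card = n ∧ ∑ i ∈ I, a i = 0

/-- The lengths `m ≥ k` such that each sequence of length `m` in `ℤ/nℤ` with at least `k` distinct
terms contains an `n`-term zero sum. -/
def gLengths (n k : ℕ) : Set ℕ :=
  {m | k ≤ m ∧ ∀ a : Fin m → ZMod n,
    k ≤ (Finset.univ.image a).card → HasNTermZeroSum n a}

/-- The function `g(n,k)`: the least element of `gLengths n k`. -/
noncomputable def gFun (n k : ℕ) : ℕ := sInf (gLengths n k)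

/-! ### Scherk's theorem and short zero sums. -/

section ZeroSumSets

open Finset
open scoped Pointwise

/-! Upper bound: take a sequence of length `n + l - 1` with `n < 2 * l` and no `n`-term zero sum,
translated so that 0 is a most frequent term, occurring `h` times. Padding with zeros shows that
zero sums `W` of nonzero terms satisfy `#W + h < n` (`card_zero_sum_add_card_zeros_lt`). For `W` of
maximal length, the remaining nonzero terms `R` are zero-free and number at least `l > n / 2`, so by
Savchev–Chen (`ZeroFree.exists_eq_nsmul`) they are small multiples of a generator. Exchanging parts
of `W` and `R` then forces every term to be close to 0 modulo `n` in that coordinate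
(`card_image_le_of_maximal_zero_sum`). Distinct values cost a triangular number on either side of
{0, 1}, which bounds their number.

Lower bound: many zeros and ones together with -1, …, -s and 2, …, t + 1, chosen so that all
`n`-term integer sums lie strictly between 0 and `n`. -/

/-- Scherk's theorem. -/
theorem card_add_card_le_card_add_of_unique_zero {G : Type*} [AddCommGroup G] [DecidableEq G]
    (A B : Finset G) (hA : 0 ∈ A) (hB : 0 ∈ B)
    (h : ∀ a ∈ A, ∀ b ∈ B, a + b = 0 → b = 0) : #A + #B ≤ #(A + B) + 1 := by
  induction hc : #B using Nat.strong_induction_on generalizing A B with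
  | _ c ih =>
  by_cases hsub : ∀ a ∈ A, ∀ b ∈ B, a + b ∈ A
  · have hB1 : B = {0} := by
      refine eq_singleton_iff_unique_mem.2 ⟨hB, fun b hb => ?_⟩
      have hinj : Set.InjOn (fun a => a + b) (A : Set G) := fun x _ y _ hxy => by simpa using hxy
      have hmap : Set.MapsTo (fun a => a + b) (A : Set G) (A : Set G) := fun x hx => hsub x hx b hb
      obtain ⟨a, ha, hab⟩ := Finset.surjOn_of_injOn_of_card_le _ hmap hinj le_rfl hA
      exact h a ha b hb hab
    subst hB1
    simp only [card_singleton] at hc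
    subst hc
    simp
  · push Not at hsub
    obtain ⟨a, ha, b₀, hb₀, hab₀⟩ := hsub
    -- Transform: move `a + B'` into `A` and drop `B'` from `B`. The total size is kept, and the
    -- sumset stays in `A + B` since `(a + b) + z = (a + z) + b` with `a + z ∈ A`.
    set B' := B.filter (fun b => a + b ∉ A) with hB'
    have hdisj : Disjoint A (B'.image (a + ·)) := by
      rw [Finset.disjoint_right]
      intro x hx
      obtain ⟨b, hb, rfl⟩ := mem_image.1 hx
      exact (mem_filter.1 hb).2
    have hcardB' : #(B'.image (a + ·)) = #B' :=
      card_image_of_injective _ (add_right_injective a)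
    have hB'pos : 0 < #B' := card_pos.2 ⟨b₀, mem_filter.2 ⟨hb₀, hab₀⟩⟩
    have hsplit : #(B \ B') + #B' = #B := card_sdiff_add_card_eq_card (filter_subset _ _)
    have key : ∀ b ∈ B \ B', b ∈ B ∧ a + b ∈ A := by
      intro b hb
      rw [mem_sdiff, hB', mem_filter] at hb
      exact ⟨hb.1, by by_contra hn; exact hb.2 ⟨hb.1, hn⟩⟩
    have h1 := ih #(B \ B') (by omega) (A ∪ B'.image (a + ·)) (B \ B')
      (mem_union_left _ hA) (mem_sdiff.2 ⟨hB, by simp [hB', ha]⟩) ?_ rfl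
    · rw [card_union_of_disjoint hdisj, hcardB'] at h1
      have h2 : #((A ∪ B'.image (a + ·)) + B \ B') ≤ #(A + B) := by
        apply card_le_card
        intro x hx
        obtain ⟨y, hy, z, hz, rfl⟩ := mem_add.1 hx
        obtain ⟨hz1, hz2⟩ := key z hz
        rcases mem_union.1 hy with hy | hy
        · exact add_mem_add hy hz1
        · obtain ⟨b, hb, rfl⟩ := mem_image.1 hy
          rw [add_right_comm]
          exact add_mem_add hz2 (mem_filter.1 hb).1
      omega
    · intro y hy z hz hyz
      obtain ⟨hz1, hz2⟩ := key z hz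
      rcases mem_union.1 hy with hy | hy
      · exact h y hy z hz1 hyz
      · obtain ⟨b, hb, rfl⟩ := mem_image.1 hy
        rw [add_right_comm] at hyz
        have hb0 := h _ hz2 b (mem_filter.1 hb).1 hyz
        subst hb0
        exact absurd (mem_filter.1 hb).2 (by simpa using ha)

/-- Values are distinct within each colour class of `κ`. Without a rainbow zero sum, Scherk's
theorem makes each class enlarge the set of rainbow sums by at least its size, ending with more than
`|G|` sums. -/
theorem exists_rainbow_zero_sum {ι G : Type*} [DecidableEq ι] [AddCommGroup G] [Fintype G]
    [DecidableEq G] (a : ι → G) (T : Finset ι) (hT : Fintype.card G ≤ #T) (h : ℕ) (κ : ι → ℕ)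
    (hκ : ∀ i ∈ T, κ i < h) (hinj : ∀ i ∈ T, ∀ j ∈ T, a i = a j → κ i = κ j → i = j) :
    ∃ U ⊆ T, U.Nonempty ∧ Set.InjOn κ (U : Set ι) ∧ ∑ i ∈ U, a i = 0 := by
  by_contra! hno
  set rainbow : ℕ → Finset (Finset ι) := fun c =>
    T.powerset.filter (fun U => Set.InjOn κ (U : Set ι) ∧ ∀ i ∈ U, κ i < c) with hrb
  have mem_rb : ∀ c U, U ∈ rainbow c ↔ U ⊆ T ∧ Set.InjOn κ (U : Set ι) ∧ ∀ i ∈ U, κ i < c := by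
    intro c U; simp [hrb]
  have main : ∀ c, #(T.filter (fun i => κ i < c)) + 1
      ≤ #((rainbow c).image (fun U => ∑ i ∈ U, a i)) := by
    intro c
    induction c with
    | zero =>
      simp only [Nat.not_lt_zero, filter_false, card_empty, zero_add]
      refine card_pos.2 ⟨0, mem_image.2 ⟨∅, (mem_rb _ _).2 ⟨by simp, by simp, by simp⟩, by simp⟩⟩
    | succ c ih =>
      set F := T.filter (fun i => κ i = c) with hF
      have hFinj : Set.InjOn a (F : Set ι) := by
        intro i hi j hj hij
        obtain ⟨hi1, hi2⟩ := mem_filter.1 hi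
        obtain ⟨hj1, hj2⟩ := mem_filter.1 hj
        exact hinj i hi1 j hj1 hij (hi2.trans hj2.symm)
      have h0 : (0 : G) ∉ F.image a := by
        intro hm
        obtain ⟨i, hi, hi0⟩ := mem_image.1 hm
        exact hno {i} (by simpa using (mem_filter.1 hi).1) (by simp) (by simp) (by simpa using hi0)
      have hins : ∀ U ∈ rainbow c, ∀ i ∈ F, insert i U ∈ rainbow (c + 1) ∧ i ∉ U := by
        intro U hU i hi
        obtain ⟨hU1, hU2, hU3⟩ := (mem_rb _ _).1 hU
        obtain ⟨hi1, hi2⟩ := mem_filter.1 hi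
        have hiU : i ∉ U := fun hm => by have := hU3 i hm; omega
        refine ⟨(mem_rb _ _).2 ⟨insert_subset hi1 hU1, ?_, ?_⟩, hiU⟩
        · rw [coe_insert, Set.injOn_insert (by simpa using hiU)]
          refine ⟨hU2, ?_⟩
          rintro ⟨j, hj, hji⟩
          have := hU3 j hj
          omega
        · intro j hj
          rcases mem_insert.1 hj with rfl | hj
          · omega
          · have := hU3 j hj; omega
      have hs := card_add_card_le_card_add_of_unique_zero
        ((rainbow c).image (fun U => ∑ i ∈ U, a i)) (insert 0 (F.image a))
        (mem_image.2 ⟨∅, (mem_rb _ _).2 ⟨by simp, by simp, by simp⟩, by simp⟩)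
        (mem_insert_self _ _) ?_
      · have hsub : (rainbow c).image (fun U => ∑ i ∈ U, a i) + insert 0 (F.image a) ⊆
            (rainbow (c + 1)).image (fun U => ∑ i ∈ U, a i) := by
          intro x hx
          obtain ⟨y, hy, z, hz, rfl⟩ := mem_add.1 hx
          obtain ⟨U, hU, rfl⟩ := mem_image.1 hy
          rcases mem_insert.1 hz with rfl | hz
          · obtain ⟨hU1, hU2, hU3⟩ := (mem_rb _ _).1 hU
            exact mem_image.2 ⟨U, (mem_rb _ _).2 ⟨hU1, hU2, fun i hi => by
              have := hU3 i hi; omega⟩, by simp⟩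
          · obtain ⟨i, hi, rfl⟩ := mem_image.1 hz
            obtain ⟨h1, h2⟩ := hins U hU i hi
            exact mem_image.2 ⟨_, h1, by rw [sum_insert h2, add_comm]⟩
        have hle := card_le_card hsub
        rw [card_insert_of_notMem h0, card_image_of_injOn hFinj] at hs
        have hcard : #(T.filter (fun i => κ i < c + 1)) = #(T.filter (fun i => κ i < c)) + #F := by
          rw [← card_union_of_disjoint]
          · congr 1
            ext i
            simp only [hF, mem_filter, mem_union]
            grind
          · rw [disjoint_filter]
            intros; omega
        omega
      · intro y hy z hz hyz
        obtain ⟨U, hU, rfl⟩ := mem_image.1 hy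
        rcases mem_insert.1 hz with rfl | hz
        · rfl
        · obtain ⟨i, hi, rfl⟩ := mem_image.1 hz
          obtain ⟨h1, h2⟩ := hins U hU i hi
          obtain ⟨h3, h4, -⟩ := (mem_rb _ _).1 h1
          exact absurd (by rw [sum_insert h2, add_comm]; exact hyz)
            (hno _ h3 (insert_nonempty _ _) h4)
  have hm := main h
  rw [filter_true_of_mem hκ] at hm
  have := card_le_univ ((rainbow h).image (fun U => ∑ i ∈ U, a i))
  omega

/-- A sequence of length at least `|G|` has a nonempty zero-sum subsequence whose length does not
exceed the maximum multiplicity of a term. -/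
theorem exists_short_zero_sum {ι G : Type*} [LinearOrder ι] [AddCommGroup G] [Fintype G]
    [DecidableEq G] (a : ι → G) (T : Finset ι) (hT : Fintype.card G ≤ #T) (h : ℕ)
    (hmult : ∀ x, #(T.filter (fun i => a i = x)) ≤ h) :
    ∃ U ⊆ T, U.Nonempty ∧ #U ≤ h ∧ ∑ i ∈ U, a i = 0 := by
  -- Colour each index by its rank among the occurrences of its value: at most `h` colours, so a
  -- rainbow set has at most `h` elements.
  set κ : ι → ℕ := fun i => #(T.filter (fun j => a j = a i ∧ j < i)) with hκ
  have hlt : ∀ i ∈ T, ∀ j ∈ T, a i = a j → i < j → κ i < κ j := by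
    intro i hi j hj hij hlt
    apply card_lt_card
    rw [Finset.ssubset_iff_of_subset]
    · exact ⟨i, by simp [hi, hij, hlt], by simp⟩
    · intro l hl
      simp only [mem_filter] at hl ⊢
      exact ⟨hl.1, hl.2.1.trans hij, hl.2.2.trans hlt⟩
  have hκh : ∀ i ∈ T, κ i < h := by
    intro i hi
    refine lt_of_lt_of_le (card_lt_card ?_) (hmult (a i))
    rw [Finset.ssubset_iff_of_subset]
    · exact ⟨i, by simp [hi], by simp⟩
    · intro l hl
      simp only [mem_filter] at hl ⊢
      exact ⟨hl.1, hl.2.1⟩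
  obtain ⟨U, hU, hne, hinj, hsum⟩ := exists_rainbow_zero_sum a T hT h κ hκh (by
    intro i hi j hj hij hκij
    rcases lt_trichotomy i j with hl | hl | hl
    · have := hlt i hi j hj hij hl; omega
    · exact hl
    · have := hlt j hj i hi hij.symm hl; omega)
  refine ⟨U, hU, hne, ?_, hsum⟩
  have := Finset.card_le_card_of_injOn (t := range h) κ
    (fun i hi => by simpa using hκh i (hU hi)) hinj
  simpa using this

end ZeroSumSets

/-! ### Zero-free families with few subset sums. -/

section ZeroFree

open Finset
open scoped Pointwise

variable {ι G : Type*} [AddCommGroup G] [DecidableEq G]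

/-- The family `a` has no nonempty zero-sum subfamily inside `R`. -/
def ZeroFree (a : ι → G) (R : Finset ι) : Prop := ∀ I ⊆ R, ∑ i ∈ I, a i = 0 → I = ∅

/-- All sums of subfamilies of `a` inside `R`, the empty sum included. -/
def subsetSums (a : ι → G) (R : Finset ι) : Finset G := R.powerset.image (fun I => ∑ i ∈ I, a i)

theorem mem_subsetSums {a : ι → G} {R : Finset ι} {x : G} :
    x ∈ subsetSums a R ↔ ∃ I ⊆ R, ∑ i ∈ I, a i = x := by
  simp [subsetSums]

theorem zero_mem_subsetSums (a : ι → G) (R : Finset ι) : 0 ∈ subsetSums a R :=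
  mem_subsetSums.2 ⟨∅, by simp, by simp⟩

variable [DecidableEq ι]

theorem mem_subsetSums_iff_erase {a : ι → G} {R : Finset ι} {b : ι} (hb : b ∈ R) {x : G} :
    x ∈ subsetSums a R ↔
      x ∈ subsetSums a (R.erase b) ∨ ∃ y ∈ subsetSums a (R.erase b), a b + y = x := by
  constructor
  · intro hx
    obtain ⟨I, hI, rfl⟩ := mem_subsetSums.1 hx
    by_cases hbI : b ∈ I
    · exact Or.inr ⟨_, mem_subsetSums.2 ⟨I.erase b, erase_subset_erase b hI, rfl⟩,
        add_sum_erase I a hbI⟩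
    · exact Or.inl (mem_subsetSums.2 ⟨I, subset_erase.2 ⟨hI, hbI⟩, rfl⟩)
  · rintro (hx | ⟨y, hy, rfl⟩)
    · obtain ⟨I, hI, rfl⟩ := mem_subsetSums.1 hx
      exact mem_subsetSums.2 ⟨I, hI.trans (erase_subset _ _), rfl⟩
    · obtain ⟨I, hI, rfl⟩ := mem_subsetSums.1 hy
      have hbI : b ∉ I := fun h => by simpa using hI h
      exact mem_subsetSums.2 ⟨insert b I, insert_subset hb (hI.trans (erase_subset _ _)),
        sum_insert hbI⟩

theorem ZeroFree.add_ne_zero {a : ι → G} {R : Finset ι} (hR : ZeroFree a R) {b : ι} (hb : b ∈ R)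
    {y : G} (hy : y ∈ subsetSums a (R.erase b)) : a b + y ≠ 0 := by
  intro h
  obtain ⟨I, hI, rfl⟩ := mem_subsetSums.1 hy
  have hbI : b ∉ I := fun h => by simpa using hI h
  rw [← sum_insert hbI] at h
  exact insert_ne_empty _ _ (hR _ (insert_subset hb (hI.trans (erase_subset _ _))) h)

/-- If the removal of any term of a zero-free family loses at most one subset sum, then all the
terms are equal. -/
theorem ZeroFree.eq_of_card_subsetSums_le {a : ι → G} {R : Finset ι} (hR : ZeroFree a R)
    (h : ∀ b ∈ R, #(subsetSums a R) ≤ #(subsetSums a (R.erase b)) + 1) {b c : ι} (hb : b ∈ R)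
    (hc : c ∈ R) : a b = a c := by
  by_contra hbc
  -- Comparing sizes, the translate by `a d` of the sums avoiding `d` fills all nonzero sums.
  have step : ∀ d ∈ R, ∀ x ∈ subsetSums a R, x ≠ 0 → x - a d ∈ subsetSums a (R.erase d) := by
    intro d hd x hx hx0
    have hsub : (subsetSums a (R.erase d)).image (a d + ·) ⊆ (subsetSums a R).erase 0 := by
      intro z hz
      obtain ⟨y, hy, rfl⟩ := mem_image.1 hz
      exact mem_erase.2 ⟨hR.add_ne_zero hd hy, (mem_subsetSums_iff_erase hd).2 (Or.inr ⟨y, hy, rfl⟩)⟩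
    have heq := eq_of_subset_of_card_le hsub (by
      rw [card_erase_of_mem (zero_mem_subsetSums a R),
        card_image_of_injective _ (add_right_injective _)]
      have := h d hd
      omega)
    have hx' := mem_erase.2 ⟨hx0, hx⟩
    rw [← heq] at hx'
    obtain ⟨y, hy, rfl⟩ := mem_image.1 hx'
    simpa using hy
  -- Removing any term loses exactly the total sum, so the remaining sums do not depend on `d`.
  have herase : ∀ d ∈ R, subsetSums a (R.erase d) = (subsetSums a R).erase (∑ i ∈ R, a i) := by
    intro d hd
    refine eq_of_subset_of_card_le (fun x hx => ?_) ?_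
    · obtain ⟨I, hI, rfl⟩ := mem_subsetSums.1 hx
      have hIR := hI.trans (erase_subset _ _)
      refine mem_erase.2 ⟨fun hsum => ?_, mem_subsetSums.2 ⟨I, hIR, rfl⟩⟩
      have h0 := hR (R \ I) sdiff_subset (by
        have := sum_sdiff (f := a) hIR
        rw [hsum] at this
        simpa using this)
      have hdI := sdiff_eq_empty_iff_subset.1 h0 hd
      simpa using hI hdI
    · rw [card_erase_of_mem (mem_subsetSums.2 ⟨R, Subset.rfl, rfl⟩)]
      have := h d hd
      omega
  have hb0 : a b ≠ 0 := by
    simpa using hR.add_ne_zero hb (zero_mem_subsetSums a _)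
  have h1 := step c hc (a b) (mem_subsetSums.2 ⟨{b}, by simpa using hb, by simp⟩) hb0
  have h2 := step b hb _ (mem_of_mem_erase (herase c hc ▸ h1)) (sub_ne_zero.2 hbc)
  rw [sub_sub_cancel_left, herase b hb, ← herase c hc] at h2
  exact hR.add_ne_zero hc h2 (add_neg_cancel _)

/-- A zero-free family with few subset sums consists of small positive multiples of one element
(Savchev–Chen, Yuan). -/
theorem ZeroFree.exists_eq_nsmul [Finite G] {a : ι → G} {R : Finset ι} (hR : ZeroFree a R)
    (hcard : #(subsetSums a R) + 1 ≤ 2 * #R) :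
    ∃ (g : G) (x : ι → ℕ), (∀ i ∈ R, 1 ≤ x i ∧ a i = x i • g) ∧ ∑ i ∈ R, x i < addOrderOf g ∧
      subsetSums a R = (range (∑ i ∈ R, x i + 1)).image (· • g) := by
  induction hc : #R generalizing R with
  | zero => omega
  | succ c ih =>
  by_cases hall : ∀ b ∈ R, #(subsetSums a R) ≤ #(subsetSums a (R.erase b)) + 1
  · obtain ⟨b, hb⟩ : R.Nonempty := card_pos.1 (by omega)
    have heq : ∀ i ∈ R, a i = a b := fun i hi => hR.eq_of_card_subsetSums_le hall hi hb
    have hsumI : ∀ I ⊆ R, ∑ i ∈ I, a i = #I • a b := fun I hI => by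
      rw [sum_congr rfl (fun i hi => heq i (hI hi)), sum_const]
    refine ⟨a b, fun _ => 1, fun i hi => ⟨le_rfl, by simp [heq i hi]⟩, ?_, ?_⟩
    · simp only [sum_const, smul_eq_mul, mul_one]
      by_contra! hle
      obtain ⟨I, hI, hIc⟩ := exists_subset_card_eq hle
      have h0 := hR I hI (by rw [hsumI I hI, hIc, addOrderOf_nsmul_eq_zero])
      rw [h0, card_empty] at hIc
      exact (addOrderOf_pos (a b)).ne hIc
    · ext y
      simp only [sum_const, smul_eq_mul, mul_one, mem_image, mem_range, mem_subsetSums]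
      constructor
      · rintro ⟨I, hI, rfl⟩
        exact ⟨#I, Nat.lt_succ_of_le (card_le_card hI), (hsumI I hI).symm⟩
      · rintro ⟨j, hj, rfl⟩
        obtain ⟨I, hI, hIc⟩ := exists_subset_card_eq (Nat.le_of_lt_succ hj)
        exact ⟨I, hI, by rw [hsumI I hI, hIc]⟩
  · push Not at hall
    obtain ⟨b, hb, hlt⟩ := hall
    have hcb : #(R.erase b) = c := by rw [card_erase_of_mem hb]; omega
    obtain ⟨g, x, hx, hS, hsums⟩ := ih (R := R.erase b)
      (fun I hI => hR I (hI.trans (erase_subset _ _))) (by omega) hcb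
    set S := ∑ i ∈ R.erase b, x i with hSdef
    have hScard : #(subsetSums a (R.erase b)) = S + 1 := by
      rw [hsums, card_image_of_injOn, card_range]
      intro i hi j hj hij
      simp only [coe_range, Set.mem_Iio] at hi hj
      exact nsmul_injOn_Iio_addOrderOf (by simp; omega) (by simp; omega) hij
    have hcS : c ≤ S := by
      rw [← hcb, card_eq_sum_ones]
      exact sum_le_sum fun i hi => (hx i hi).1
    have hmem : ∀ j ≤ S, j • g ∈ subsetSums a (R.erase b) := fun j hj => by
      rw [hsums]
      exact mem_image_of_mem _ (mem_range.2 (by omega))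
    have hunion : subsetSums a R =
        subsetSums a (R.erase b) ∪ (subsetSums a (R.erase b)).image (a b + ·) := by
      ext y
      rw [mem_subsetSums_iff_erase hb, mem_union, mem_image]
    -- Disjointness would give `2 * (S + 1) ≥ 2 * #R` sums. An overlap makes `a b` a multiple `t •
    -- g` with `1 ≤ t ≤ S`.
    have hndisj : ¬ Disjoint (subsetSums a (R.erase b))
        ((subsetSums a (R.erase b)).image (a b + ·)) := by
      intro hd
      rw [hunion, card_union_of_disjoint hd, card_image_of_injective _ (add_right_injective _),
        hScard] at hcard
      omega
    rw [Finset.not_disjoint_iff] at hndisj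
    obtain ⟨z, hz1, hz2⟩ := hndisj
    rw [hsums] at hz1 hz2
    obtain ⟨i, hi, rfl⟩ := mem_image.1 hz1
    obtain ⟨w, hw, hwi⟩ := mem_image.1 hz2
    obtain ⟨j, hj, rfl⟩ := mem_image.1 hw
    simp only [mem_range] at hi hj
    have hij : j < i := by
      by_contra! hle
      refine hR.add_ne_zero hb (hmem (j - i) (by omega)) ?_
      have h1 : j • g = (j - i) • g + i • g := by rw [← add_nsmul]; congr 1; omega
      rw [h1, ← add_assoc] at hwi
      simpa using hwi
    obtain ⟨t, rfl⟩ : ∃ t, i = t + j := ⟨i - j, by omega⟩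
    have hbt : a b = t • g := by
      rw [add_nsmul] at hwi
      simpa using hwi
    have htS : S + t < addOrderOf g := by
      by_contra! hle
      refine hR.add_ne_zero hb (hmem (addOrderOf g - t) (by omega)) ?_
      rw [hbt, ← add_nsmul]
      rw [show t + (addOrderOf g - t) = addOrderOf g by omega, addOrderOf_nsmul_eq_zero]
    have hsum : ∑ l ∈ R, Function.update x b t l = t + S := by
      rw [← add_sum_erase R _ hb, Function.update_self]
      congr 1
      exact sum_congr rfl fun l hl => Function.update_of_ne (ne_of_mem_erase hl) _ _
    refine ⟨g, Function.update x b t, ?_, ?_, ?_⟩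
    · intro l hl
      by_cases hlb : l = b
      · subst hlb
        simp only [Function.update_self]
        exact ⟨by omega, hbt⟩
      · rw [Function.update_of_ne hlb]
        exact hx l (mem_erase.2 ⟨hlb, hl⟩)
    · rw [hsum]; omega
    · rw [hsum, hunion, hsums]
      ext y
      simp only [mem_union, mem_image, mem_range]
      constructor
      · rintro (⟨l, hl, rfl⟩ | ⟨_, ⟨l, hl, rfl⟩, rfl⟩)
        · exact ⟨l, by omega, rfl⟩
        · exact ⟨t + l, by omega, by rw [add_nsmul, hbt]⟩
      · rintro ⟨l, hl, rfl⟩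
        by_cases hlS : l < S + 1
        · exact Or.inl ⟨l, hlS, rfl⟩
        · refine Or.inr ⟨_, ⟨l - t, by omega, rfl⟩, ?_⟩
          rw [hbt, ← add_nsmul]
          congr 1; omega

end ZeroFree

/-! ### Subset sums of positive integers. -/

section SubsetSumsNat

open Finset

variable {ι : Type*} [DecidableEq ι]

/-- The average is below 2. Deleting a term larger than 1 preserves this, and that term is at most
one more than the sum of the others, so no gap appears when it is put back. -/
theorem exists_subset_sum_eq (x : ι → ℕ) (R : Finset ι) (hpos : ∀ i ∈ R, 1 ≤ x i)
    (hR : ∑ i ∈ R, x i + 1 ≤ 2 * #R) (t : ℕ) (ht : t ≤ ∑ i ∈ R, x i) :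
    ∃ Q ⊆ R, ∑ i ∈ Q, x i = t := by
  induction hc : #R generalizing R t with
  | zero => omega
  | succ r ih =>
  by_cases hone : ∀ i ∈ R, x i = 1
  · have hsum : ∀ Q ⊆ R, ∑ i ∈ Q, x i = #Q := fun Q hQ => by
      rw [card_eq_sum_ones]
      exact sum_congr rfl fun i hi => hone i (hQ hi)
    rw [hsum R Subset.rfl] at ht
    obtain ⟨Q, hQ, hQc⟩ := exists_subset_card_eq ht
    exact ⟨Q, hQ, by rw [hsum Q hQ, hQc]⟩
  · push Not at hone
    obtain ⟨m, hm, hm1⟩ := hone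
    have hm0 := hpos m hm
    have hcard : #(R.erase m) = r := by rw [card_erase_of_mem hm]; omega
    have hsum := add_sum_erase R x hm
    have hge : #(R.erase m) ≤ ∑ i ∈ R.erase m, x i := by
      rw [card_eq_sum_ones]
      exact sum_le_sum fun i hi => hpos i (mem_of_mem_erase hi)
    have hih := fun t ht => ih (R.erase m) (fun i hi => hpos i (mem_of_mem_erase hi))
      (by omega) t ht hcard
    by_cases htm : t ≤ ∑ i ∈ R.erase m, x i
    · obtain ⟨Q, hQ, hQs⟩ := hih t htm
      exact ⟨Q, hQ.trans (erase_subset _ _), hQs⟩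
    · obtain ⟨Q, hQ, hQs⟩ := hih (t - x m) (by omega)
      refine ⟨insert m Q, insert_subset hm (hQ.trans (erase_subset _ _)), ?_⟩
      rw [sum_insert (fun h => by simpa using hQ h), hQs]
      omega

/-- Reserve a term equal to 1 and represent `t - 1` by the others; the extra slack keeps their
average below 2. -/
theorem exists_subset_sum_eq_of_two_le (x : ι → ℕ) (R : Finset ι) (hpos : ∀ i ∈ R, 1 ≤ x i)
    (hR : ∑ i ∈ R, x i + 2 ≤ 2 * #R) (t : ℕ) (ht : t ≤ ∑ i ∈ R, x i) (ht2 : 2 ≤ t) :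
    ∃ Q ⊆ R, ∑ i ∈ Q, x i = t ∧ 2 ≤ #Q := by
  obtain ⟨m, hm, hm1⟩ : ∃ m ∈ R, x m = 1 := by
    by_contra! hno
    have : ∑ i ∈ R, 2 ≤ ∑ i ∈ R, x i := sum_le_sum fun i hi => by
      have := hpos i hi; have := hno i hi; omega
    rw [sum_const, smul_eq_mul] at this
    omega
  have hsum := add_sum_erase R x hm
  have hcard := card_erase_add_one hm
  obtain ⟨Q, hQ, hQs⟩ := exists_subset_sum_eq x (R.erase m)
    (fun i hi => hpos i (mem_of_mem_erase hi)) (by omega) (t - 1) (by omega)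
  have hmQ : m ∉ Q := fun h => by simpa using hQ h
  have hne : Q.Nonempty := by
    rw [nonempty_iff_ne_empty]
    rintro rfl
    simp at hQs
    omega
  refine ⟨insert m Q, insert_subset hm (hQ.trans (erase_subset _ _)), ?_, ?_⟩
  · rw [sum_insert hmQ]; omega
  · rw [card_insert_of_notMem hmQ]
    have := hne.card_pos
    omega

theorem card_mul_card_add_one_le_two_mul_sum (F : Finset ℕ) (hF : ∀ x ∈ F, 1 ≤ x) :
    #F * (#F + 1) ≤ 2 * ∑ x ∈ F, x := by
  induction F using Finset.induction_on_max with
  | empty => simp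
  | insert a s hs ih =>
    have ha : a ∉ s := fun h => lt_irrefl _ (hs a h)
    have hle : #s ≤ #(Finset.Ico 1 a) := card_le_card fun x hx =>
      mem_Ico.2 ⟨hF x (mem_insert_of_mem hx), hs x hx⟩
    have ha1 := hF a (mem_insert_self _ _)
    rw [Nat.card_Ico] at hle
    have := ih fun x hx => hF x (mem_insert_of_mem hx)
    rw [card_insert_of_notMem ha, sum_insert ha]
    have h2 : #s + 1 ≤ a := by omega
    nlinarith

theorem card_image_mul_le_two_mul_sum (f : ι → ℕ) (P : Finset ι) (hf : ∀ i ∈ P, 1 ≤ f i) :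
    #(P.image f) * (#(P.image f) + 1) ≤ 2 * ∑ i ∈ P, f i := by
  have h1 : ∑ x ∈ P.image f, x ≤ ∑ i ∈ P, f i := by
    clear hf
    induction P using Finset.induction_on with
    | empty => simp
    | insert i P hi ih =>
      rw [image_insert, sum_insert hi]
      by_cases hm : f i ∈ P.image f
      · rw [insert_eq_of_mem hm]; omega
      · rw [sum_insert hm]; omega
  have h2 := card_mul_card_add_one_le_two_mul_sum (P.image f) (by simpa using hf)
  omega

/-- A set of weights, none of which exceeds `M`, with sum more than `M` contains a subset whose
sum exceeds `M` only slightly. -/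
theorem exists_subset_sum_gt_card_le (y : ι → ℕ) (N : Finset ι) (M : ℕ)
    (hy : ∀ i ∈ N, 1 ≤ y i ∧ y i ≤ M) (hN : M < ∑ i ∈ N, y i) :
    ∃ U ⊆ N, M < ∑ i ∈ U, y i ∧ ∑ i ∈ U, y i + #U ≤ 2 * M + 2 := by
  -- An inclusion-minimal `U` drops to at most `M` on losing its least weight; the bound then
  -- follows from `p + q ≤ p * q + 1` for positive `p`, `q`.
  obtain ⟨U, hU, hmin⟩ := exists_minimal (s := N.powerset.filter (fun U => M < ∑ i ∈ U, y i))
    ⟨N, by simp [hN]⟩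
  simp only [mem_filter, mem_powerset] at hU hmin
  have hne : U.Nonempty := by
    rw [nonempty_iff_ne_empty]
    rintro rfl
    simp at hU
  obtain ⟨m, hm, hmm⟩ := exists_min_image U y hne
  have hsum := add_sum_erase U y hm
  have hcard := card_erase_add_one hm
  have hlt : ∑ i ∈ U.erase m, y i ≤ M := by
    by_contra! hgt
    have := hmin ⟨(erase_subset _ _).trans hU.1, hgt⟩ (erase_subset _ _) hm
    simp at this
  have hge : #(U.erase m) * y m ≤ ∑ i ∈ U.erase m, y i := by
    rw [← smul_eq_mul, ← sum_const]
    exact sum_le_sum fun i hi => hmm i (mem_of_mem_erase hi)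
  refine ⟨U, hU.1, hU.2, ?_⟩
  have hm1 := hy m (hU.1 hm)
  by_cases h0 : #(U.erase m) = 0
  · rw [card_eq_zero] at h0
    rw [h0, sum_empty] at hsum
    omega
  · have : #(U.erase m) + y m ≤ #(U.erase m) * y m + 1 := by
      obtain ⟨p, hp⟩ := Nat.exists_eq_succ_of_ne_zero h0
      obtain ⟨q, hq⟩ := Nat.exists_eq_succ_of_ne_zero (show y m ≠ 0 by omega)
      rw [hp, hq]
      simp only [Nat.succ_eq_add_one]
      nlinarith [Nat.zero_le (p * q)]
    omega

end SubsetSumsNat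

/-! ### Exchange arguments around a longest zero sum. -/

section Structure

open Finset

variable {ι : Type*} [Fintype ι] [DecidableEq ι]

theorem card_image_le_of_maximal_zero_sum {n l : ℕ} (b : ι → ℕ) (hb : ∀ i, b i < n)
    (W R : Finset ι) (hdisj : Disjoint W R) (hWR : ∀ i, i ∈ W ∪ R ↔ b i ≠ 0)
    (hmax : ∀ V ⊆ W ∪ R, n ∣ ∑ i ∈ V, b i → #V ≤ #W) (hW : n ∣ ∑ i ∈ W, b i)
    (hzero : #W + #(univ.filter fun i => b i = 0) < n) (hR : ∑ i ∈ R, b i < n)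
    (hcard : Fintype.card ι + 1 = n + l) (hl : n < 2 * l) :
    ∃ s t, #(univ.image b) ≤ s + t + 2 ∧ s * (s + 1) + t * (t + 1) + 2 * l + 2 ≤ 2 * n := by
  set S := ∑ i ∈ R, b i with hS
  set h := #(univ.filter fun i => b i = 0) with hh
  have hposR : ∀ i ∈ R, 1 ≤ b i := fun i hi =>
    Nat.one_le_iff_ne_zero.2 ((hWR i).1 (mem_union_right _ hi))
  have hposW : ∀ i ∈ W, 1 ≤ b i := fun i hi =>
    Nat.one_le_iff_ne_zero.2 ((hWR i).1 (mem_union_left _ hi))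
  have htotal : h + (#W + #R) = Fintype.card ι := by
    rw [← card_union_of_disjoint hdisj, ← card_univ, hh,
      ← card_filter_add_card_filter_not (s := univ) (fun i => b i = 0)]
    congr 2
    ext i
    simp [← hWR]
  have hRS : #R ≤ S := by
    rw [card_eq_sum_ones]
    exact sum_le_sum hposR
  -- exchanging part of `W` against part of `R` cannot lengthen `W`
  have exchange : ∀ U ⊆ W, ∀ Q ⊆ R, (n : ℤ) ∣ ∑ i ∈ Q, (b i : ℤ) - ∑ i ∈ U, (b i : ℤ) →
      #Q ≤ #U := by
    intro U hU Q hQ hdvd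
    have hd : Disjoint (W \ U) Q := disjoint_of_subset_left sdiff_subset
      (disjoint_of_subset_right hQ hdisj)
    have h1 := hmax (W \ U ∪ Q) (union_subset_union sdiff_subset hQ) (by
      have h2 := sum_sdiff (f := fun i => (b i : ℤ)) hU
      have h3 : (n : ℤ) ∣ ∑ i ∈ W, (b i : ℤ) := by exact_mod_cast hW
      rw [sum_union hd]
      zify
      have h4 := dvd_add h3 hdvd
      rw [← h2] at h4
      obtain ⟨c, hc⟩ := h4
      exact ⟨c, by linarith⟩)
    rw [card_union_of_disjoint hd] at h1
    have := card_sdiff_add_card_eq_card hU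
    omega
  -- A term of `W` in `[2, S]` could be traded for at least two terms of `R` with the same sum.
  have hWval : ∀ i ∈ W, b i = 1 ∨ S < b i := by
    intro i hi
    by_contra! hcon
    have := hposW i hi
    obtain ⟨Q, hQ, hQs, hQ2⟩ := exists_subset_sum_eq_of_two_le b R hposR (by omega) (b i) hcon.2
      (by omega)
    have := exchange {i} (by simpa using hi) Q hQ (by
      rw [sum_singleton, ← Nat.cast_sum, hQs]; simp)
    rw [card_singleton] at this
    omega
  set N := W.filter (fun i => S < b i) with hN
  set C := W.filter (fun i => ¬ S < b i) with hC
  have hNC : #N + #C = #W := card_filter_add_card_filter_not _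
  have hNW : N ⊆ W := filter_subset _ _
  have hCone : ∀ i ∈ C, b i = 1 := fun i hi => by
    obtain ⟨h1, h2⟩ := mem_filter.1 hi
    exact (hWval i h1).resolve_right h2
  have hsumN : ∀ U ⊆ N, ∑ i ∈ U, (b i : ℤ) = n * #U - ∑ i ∈ U, (n - b i : ℕ) := by
    intro U _
    have : ∀ i ∈ U, (b i : ℤ) = n - (n - b i : ℕ) := fun i _ => by
      have := hb i; omega
    rw [sum_congr rfl this, sum_sub_distrib, sum_const, nsmul_eq_mul, mul_comm]
    push_cast
    rfl
  set Y := ∑ i ∈ N, (n - b i) with hY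
  -- Otherwise some `U ⊆ N` has deficit `Y'` just above `n - 1 - S`. Trimming `R` to sum `n - Y'`
  -- and exchanging it for `U` gives `#R + S ≤ n`, against `n < 2 * l`.
  have hYS : Y + S < n := by
    by_contra! hge
    obtain ⟨U, hU, hU1, hU2⟩ := exists_subset_sum_gt_card_le (fun i => n - b i) N (n - 1 - S)
      (fun i hi => by have := (mem_filter.1 hi).2; have := hb i; omega) (by omega)
    set Y' := ∑ i ∈ U, (n - b i) with hY'
    have hUpos : 1 ≤ #U := by
      rw [Nat.one_le_iff_ne_zero, ne_eq, card_eq_zero]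
      rintro h0
      rw [h0] at hY'
      simp only [sum_empty] at hY'
      omega
    obtain ⟨D, hD, hDs⟩ := exists_subset_sum_eq b R hposR (by omega) (Y' + S - n) (by omega)
    have hDc : #D ≤ Y' + S - n := by
      rw [← hDs, card_eq_sum_ones]
      exact sum_le_sum fun i hi => hposR i (hD hi)
    have hRD := card_sdiff_add_card_eq_card hD
    have hRDs := sum_sdiff (f := b) hD
    have := exchange U (hU.trans hNW) (R \ D) sdiff_subset (by
      rw [hsumN U hU, ← hY', ← Nat.cast_sum]
      have : ((∑ i ∈ R \ D, b i : ℕ) : ℤ) = n - Y' := by omega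
      rw [this]
      exact ⟨1 - #U, by ring⟩)
    omega
  have hCY : #C = Y := by
    have h1 : ∑ i ∈ N, (b i : ℤ) + ∑ i ∈ C, (b i : ℤ) = ∑ i ∈ W, (b i : ℤ) :=
      sum_filter_add_sum_filter_not _ _ _
    have h2 : ∑ i ∈ C, (b i : ℤ) = #C := by
      rw [sum_congr rfl fun i hi => by rw [hCone i hi]]
      simp
    have h3 : (n : ℤ) ∣ ∑ i ∈ W, (b i : ℤ) := by exact_mod_cast hW
    rw [← h1, h2, hsumN N Subset.rfl, ← hY] at h3
    have h4 : (n : ℤ) ∣ (#C : ℤ) - Y := by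
      obtain ⟨c, hc⟩ := dvd_sub h3 (dvd_mul_right (n : ℤ) #N)
      exact ⟨c, by linarith⟩
    have h5 := Int.eq_zero_of_abs_lt_dvd h4 (by rw [abs_lt]; omega)
    omega
  have hNY : #N ≤ Y := by
    rw [card_eq_sum_ones]
    exact sum_le_sum fun i _ => by have := hb i; omega
  set P := R.filter (fun i => ¬ b i = 1) with hP
  set O := R.filter (fun i => b i = 1) with hO
  have hPR : P ⊆ R := filter_subset _ _
  have hOP : #O + #P = #R := card_filter_add_card_filter_not _
  have hOPs : ∑ i ∈ O, b i + ∑ i ∈ P, b i = S := sum_filter_add_sum_filter_not _ _ _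
  have hOs : ∑ i ∈ O, b i = #O := by
    rw [card_eq_sum_ones]
    exact sum_congr rfl fun i hi => (mem_filter.1 hi).2
  have hPe : ∑ i ∈ P, (b i - 1) + #P = ∑ i ∈ P, b i := by
    rw [card_eq_sum_ones, ← sum_add_distrib]
    exact sum_congr rfl fun i hi => by have := hposR i (hPR hi); omega
  have hCO : Disjoint C O := disjoint_of_subset_left (filter_subset _ _)
    (disjoint_of_subset_right (filter_subset _ _) hdisj)
  -- Otherwise `P` and enough ones sum to exactly `n`, a zero sum longer than `W`.
  have hpos_part : ∑ i ∈ P, b i + (#C + #O) < n := by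
    by_contra! hge
    rw [← card_union_of_disjoint hCO] at hge
    obtain ⟨V, hV, hVc⟩ := exists_subset_card_eq
      (show n - ∑ i ∈ P, b i ≤ #(C ∪ O) by omega)
    have hVone : ∀ i ∈ V, b i = 1 := fun i hi => by
      rcases mem_union.1 (hV hi) with hi | hi
      · exact hCone i hi
      · exact (mem_filter.1 hi).2
    have hPV : Disjoint P V := by
      rw [Finset.disjoint_left]
      intro i hi hiV
      exact (mem_filter.1 hi).2 (hVone i hiV)
    have hVs : ∑ i ∈ V, b i = #V := by
      rw [card_eq_sum_ones]
      exact sum_congr rfl hVone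
    have := hmax (P ∪ V) (union_subset (hPR.trans subset_union_right)
      (hV.trans (union_subset_union (filter_subset _ _) (filter_subset _ _)))) (by
        rw [sum_union hPV, hVs, hVc]
        exact ⟨1, by omega⟩)
    rw [card_union_of_disjoint hPV] at this
    omega
  refine ⟨#(N.image fun i => n - b i), #(P.image fun i => b i - 1), ?_, ?_⟩
  · have hsub : univ.image b ⊆ {0, 1} ∪ ((N.image fun i => n - b i).image (n - ·) ∪
        (P.image fun i => b i - 1).image (· + 1)) := by
      intro z hz
      obtain ⟨i, -, rfl⟩ := mem_image.1 hz
      rw [image_image, image_image]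
      simp only [mem_union, mem_insert, mem_singleton, mem_image, Function.comp]
      by_cases h0 : b i = 0
      · exact Or.inl (Or.inl h0)
      by_cases h1 : b i = 1
      · exact Or.inl (Or.inr h1)
      rcases mem_union.1 ((hWR i).2 h0) with hi | hi
      · refine Or.inr (Or.inl ⟨i, mem_filter.2 ⟨hi, (hWval i hi).resolve_left h1⟩, ?_⟩)
        have := hb i
        omega
      · exact Or.inr (Or.inr ⟨i, mem_filter.2 ⟨hi, h1⟩, by omega⟩)
    have h1 := card_le_card hsub
    have h2 := card_union_le ({0, 1} : Finset ℕ) ((N.image fun i => n - b i).image (n - ·) ∪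
        (P.image fun i => b i - 1).image (· + 1))
    have h3 := card_union_le ((N.image fun i => n - b i).image (n - ·))
        ((P.image fun i => b i - 1).image (· + 1))
    have h4 := card_image_le (s := N.image fun i => n - b i) (f := (n - ·))
    have h5 := card_image_le (s := P.image fun i => b i - 1) (f := (· + 1))
    have h6 := card_le_two (a := 0) (b := 1)
    omega
  · have h1 := card_image_mul_le_two_mul_sum (fun i => n - b i) N
      (fun i _ => by have := hb i; omega)
    have h2 := card_image_mul_le_two_mul_sum (fun i => b i - 1) P
      (fun i hi => by have := hposR i (hPR hi); have := (mem_filter.1 hi).2; omega)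
    omega

end Structure

/-! ### Reduction of the upper bound to the structure lemma. -/

section UpperBound

open Finset

/-- If `#W` is between `|G| - h` and `|G|`, zeros complete it to a forbidden sum. A longer `W`
descends into this window, because it loses zero sums of length at most `h` at a time. -/
theorem card_zero_sum_add_card_zeros_lt {ι G : Type*} [Fintype ι] [LinearOrder ι]
    [AddCommGroup G] [Fintype G] [DecidableEq G] (a : ι → G)
    (hno : ∀ I : Finset ι, #I = Fintype.card G → ∑ i ∈ I, a i ≠ 0)
    (hmult : ∀ x, #(univ.filter fun i => a i = x) ≤ #(univ.filter fun i => a i = 0))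
    (W : Finset ι) (hW : ∀ i ∈ W, a i ≠ 0) (hsum : ∑ i ∈ W, a i = 0) :
    #W + #(univ.filter fun i => a i = 0) < Fintype.card G := by
  induction hc : #W using Nat.strong_induction_on generalizing W with
  | _ c ih =>
  by_contra! hge
  by_cases hle : #W ≤ Fintype.card G
  · obtain ⟨Z, hZ, hZc⟩ := exists_subset_card_eq
      (show Fintype.card G - #W ≤ #(univ.filter fun i => a i = 0) by omega)
    have hZ0 : ∀ i ∈ Z, a i = 0 := fun i hi => (mem_filter.1 (hZ hi)).2
    have hd : Disjoint W Z := Finset.disjoint_left.2 fun i hi hiZ => hW i hi (hZ0 i hiZ)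
    refine hno (W ∪ Z) ?_ ?_
    · rw [card_union_of_disjoint hd]; omega
    · rw [sum_union hd, hsum, sum_eq_zero hZ0, add_zero]
  · obtain ⟨U, hU, hne, hUc, hUs⟩ := exists_short_zero_sum a W (by omega) _
      (fun x => (card_le_card (filter_subset_filter _ (subset_univ W))).trans (hmult x))
    have hcard := card_sdiff_add_card_eq_card hU
    have hsplit := sum_sdiff (f := a) hU
    have hpos := hne.card_pos
    have := ih #(W \ U) (by omega) (W \ U) (fun i hi => hW i (mem_sdiff.1 hi).1)
      (by rw [hsum, hUs, add_zero] at hsplit; exact hsplit) rfl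
    omega

theorem card_image_le_of_not_hasNTermZeroSum {n l m : ℕ} (hn : 0 < n) (a : Fin m → ZMod n)
    (ha : ¬ HasNTermZeroSum n a) (hm : m + 1 = n + l) (hl : n < 2 * l) :
    ∃ s t, #(univ.image a) ≤ s + t + 2 ∧ s * (s + 1) + t * (t + 1) + 2 * l + 2 ≤ 2 * n := by
  have : NeZero n := ⟨hn.ne'⟩
  obtain ⟨z, -, hz⟩ := exists_max_image univ (fun z => #(univ.filter fun i => a i = z)) ⟨0, mem_univ _⟩
  -- Translation does not change `n`-term sums, since `n • z = 0`.
  set a' : Fin m → ZMod n := fun i => a i - z with ha'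
  have hno : ∀ I : Finset (Fin m), #I = Fintype.card (ZMod n) → ∑ i ∈ I, a' i ≠ 0 := by
    intro I hI h0
    rw [ZMod.card] at hI
    refine ha ⟨I, hI, ?_⟩
    rw [sum_sub_distrib, sum_const, hI, nsmul_eq_mul, CharP.cast_eq_zero, zero_mul, sub_zero] at h0
    exact h0
  have hmult : ∀ x, #(univ.filter fun i => a' i = x) ≤ #(univ.filter fun i => a' i = 0) := by
    intro x
    simp only [ha', sub_eq_iff_eq_add, zero_add]
    exact hz _ (mem_univ _)
  have hzs := card_zero_sum_add_card_zeros_lt a' hno hmult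
  rw [ZMod.card] at hzs
  set T := univ.filter fun i => ¬ a' i = 0 with hT
  have hTcard : #(univ.filter fun i => a' i = 0) + #T = m := by
    rw [card_filter_add_card_filter_not]; simp
  obtain ⟨W, hWmem, hWmax⟩ := exists_max_image (T.powerset.filter fun W => ∑ i ∈ W, a' i = 0) card
    ⟨∅, by simp⟩
  simp only [mem_filter, mem_powerset, and_imp] at hWmem hWmax
  obtain ⟨hWT, hWs⟩ := hWmem
  have hWlt := hzs W (fun i hi => (mem_filter.1 (hWT hi)).2) hWs
  have hRcard := card_sdiff_add_card_eq_card hWT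
  have hfree : ZeroFree a' (T \ W) := by
    intro I hI h0
    have hd : Disjoint W I := disjoint_of_subset_right hI disjoint_sdiff
    have := hWmax (W ∪ I) (union_subset hWT (hI.trans sdiff_subset))
      (by rw [sum_union hd, hWs, h0, add_zero])
    rw [card_union_of_disjoint hd] at this
    exact card_eq_zero.1 (by omega)
  obtain ⟨g, x, hx, hS, -⟩ := hfree.exists_eq_nsmul (by
    have := card_le_univ (subsetSums a' (T \ W))
    rw [ZMod.card] at this
    omega)
  have hRle : #(T \ W) ≤ ∑ i ∈ T \ W, x i := by
    rw [card_eq_sum_ones]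
    exact sum_le_sum fun i hi => (hx i hi).1
  -- The order divides `n` and exceeds `#(T \ W) ≥ l > n / 2`.
  have hord : addOrderOf g = n := by
    obtain ⟨c, hc⟩ : addOrderOf g ∣ n := by simpa using addOrderOf_dvd_card (x := g)
    have hc1 : c = 1 := by
      rcases Nat.lt_or_ge c 2 with h | h
      · interval_cases c
        · omega
        · rfl
      · have := Nat.mul_le_mul_left (addOrderOf g) h
        omega
    rw [hc1, mul_one] at hc
    exact hc.symm
  have hinj : Set.InjOn (fun k : ℕ => k • g) (Set.Iio n) := by
    have := nsmul_injOn_Iio_addOrderOf (x := g)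
    rwa [hord] at this
  have hgen : (range n).image (fun k => k • g) = univ := by
    apply eq_univ_of_card
    rw [card_image_of_injOn (by simpa using hinj), card_range, ZMod.card]
  have hex : ∀ i, ∃ k < n, k • g = a' i := fun i => by
    have := mem_univ (a' i)
    rw [← hgen] at this
    simpa using this
  choose b hb hbg using hex
  have hsum : ∀ V : Finset (Fin m), n ∣ ∑ i ∈ V, b i ↔ ∑ i ∈ V, a' i = 0 := by
    intro V
    have h := addOrderOf_dvd_iff_nsmul_eq_zero (x := g) (n := ∑ i ∈ V, b i)
    rw [hord, ← sum_nsmul_assoc] at h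
    simpa only [hbg] using h
  have hb0 : ∀ i, b i = 0 ↔ a' i = 0 := fun i => by
    rw [← hbg i]
    constructor
    · intro h; rw [h, zero_nsmul]
    · intro h; exact hinj (hb i) hn (by simpa using h)
  have hWR : W ∪ T \ W = T := union_sdiff_of_subset hWT
  obtain ⟨s, t, h1, h2⟩ := card_image_le_of_maximal_zero_sum (l := l) b hb W (T \ W)
    disjoint_sdiff
    (fun i => by rw [hWR, hT, mem_filter, ne_eq, hb0]; simp)
    (fun V hV hVs => hWmax V (hWR ▸ hV) ((hsum V).1 hVs)) ((hsum W).2 hWs)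
    (by simpa only [hb0] using hWlt)
    (by
      rw [sum_congr rfl fun i hi => ?_]
      · exact hord ▸ hS
      · have hxi := single_le_sum (f := x) (fun _ _ => Nat.zero_le _) hi
        exact hinj (hb i) (show x i < n by omega) ((hbg i).trans (hx i hi).2))
    (by simpa using hm) hl
  refine ⟨s, t, le_trans ?_ h1, h2⟩
  have : univ.image a = (univ.image b).image (fun k => k • g + z) := by
    rw [image_image]
    congr 1
    funext i
    simp only [Function.comp, hbg, ha', sub_add_cancel]
  rw [this]
  exact card_image_le

end UpperBound

/-! ### The extremal sequence. -/

section LowerBound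

open Finset

/-- The integer sequence consisting of `u` zeros, `v` ones, the terms `-1, …, -s` and the terms
`2, …, t + 1`. -/
def extremalSeq (u v s t : ℕ) : Fin u ⊕ Fin v ⊕ Fin s ⊕ Fin t → ℤ :=
  Sum.elim (fun _ => 0) (Sum.elim (fun _ => 1) (Sum.elim (fun j => -(j : ℤ) - 1) fun j => j + 2))

theorem two_mul_sum_fin_add_one (s : ℕ) : 2 * ∑ j : Fin s, ((j : ℤ) + 1) = s * (s + 1) := by
  induction s with
  | zero => simp
  | succ s ih =>
    rw [Fin.sum_univ_castSucc, mul_add]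
    simp only [Fin.val_castSucc, Fin.val_last]
    rw [ih]
    push_cast
    ring

/-- The positive parts of `1 - term` add up to `n - 1`, so `n` terms have sum at least 1. -/
theorem sum_extremalSeq_pos {n u v s t : ℕ} (hu : 2 * u + 2 * s + s * (s + 1) + 2 = 2 * n)
    (I : Finset (Fin u ⊕ Fin v ⊕ Fin s ⊕ Fin t)) (hI : #I = n) :
    0 < ∑ i ∈ I, extremalSeq u v s t i := by
  have h1 : ∑ i ∈ I, (1 - extremalSeq u v s t i) ≤
      ∑ i, max (1 - extremalSeq u v s t i) 0 :=
    (sum_le_sum fun i _ => le_max_left _ _).trans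
      (sum_le_sum_of_subset_of_nonneg (subset_univ _) fun i _ _ => le_max_right _ _)
  have h2 : ∑ i, max (1 - extremalSeq u v s t i) 0 = u + (s + ∑ j : Fin s, ((j : ℤ) + 1)) := by
    simp only [Fintype.sum_sum_type, extremalSeq, Sum.elim_inl, Sum.elim_inr]
    have e1 : ∀ j : Fin s, max (1 - (-(j : ℤ) - 1)) 0 = 1 + (j + 1) := fun j => by
      rw [max_eq_left (by omega)]; ring
    have e2 : ∀ j : Fin t, max (1 - ((j : ℤ) + 2)) 0 = 0 := fun j => max_eq_right (by omega)
    simp only [e1, e2, sum_add_distrib]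
    simp
  have h3 := two_mul_sum_fin_add_one s
  rw [sum_sub_distrib, sum_const, hI, h2] at h1
  have h4 : (2 * u + 2 * s + s * (s + 1) + 2 : ℤ) = 2 * n := by exact_mod_cast hu
  simp only [nsmul_eq_mul, mul_one] at h1
  linarith

/-- The positive terms add up to `n - 1`. -/
theorem sum_extremalSeq_lt {n u v s t : ℕ} (hv : 2 * v + 2 * t + t * (t + 1) + 2 = 2 * n)
    (I : Finset (Fin u ⊕ Fin v ⊕ Fin s ⊕ Fin t)) :
    ∑ i ∈ I, extremalSeq u v s t i < n := by
  have h1 : ∑ i ∈ I, extremalSeq u v s t i ≤ ∑ i, max (extremalSeq u v s t i) 0 :=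
    (sum_le_sum fun i _ => le_max_left _ _).trans
      (sum_le_sum_of_subset_of_nonneg (subset_univ _) fun i _ _ => le_max_right _ _)
  have h2 : ∑ i, max (extremalSeq u v s t i) 0 = v + (t + ∑ j : Fin t, ((j : ℤ) + 1)) := by
    simp only [Fintype.sum_sum_type, extremalSeq, Sum.elim_inl, Sum.elim_inr]
    have e1 : ∀ j : Fin s, max (-(j : ℤ) - 1) 0 = 0 := fun j => max_eq_right (by omega)
    have e2 : ∀ j : Fin t, max ((j : ℤ) + 2) 0 = 1 + (j + 1) := fun j => by
      rw [max_eq_left (by omega)]; ring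
    simp only [e1, e2, sum_add_distrib]
    simp
  have h3 := two_mul_sum_fin_add_one t
  have h4 : (2 * v + 2 * t + t * (t + 1) + 2 : ℤ) = 2 * n := by exact_mod_cast hv
  linarith

theorem exists_extremalSeq_eq {u v s t : ℕ} (hu : 0 < u) (hv : 0 < v) (z : ℤ)
    (hz : z ∈ Icc (-(s : ℤ)) (t + 1)) : ∃ i, extremalSeq u v s t i = z := by
  rw [mem_Icc] at hz
  rcases lt_trichotomy z 0 with h | h | h
  · exact ⟨.inr (.inr (.inl ⟨(-z - 1).toNat, by omega⟩)), by simp [extremalSeq]; omega⟩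
  · exact ⟨.inl ⟨0, hu⟩, by simp [extremalSeq, h]⟩
  · by_cases h1 : z = 1
    · exact ⟨.inr (.inl ⟨0, hv⟩), by simp [extremalSeq, h1]⟩
    · exact ⟨.inr (.inr (.inr ⟨(z - 2).toNat, by omega⟩)), by simp [extremalSeq]; omega⟩

theorem le_card_image_extremalSeq {n u v s t : ℕ} (hu : 0 < u) (hv : 0 < v)
    (hn : s + t + 2 ≤ n) :
    s + t + 2 ≤ #(univ.image fun i => (extremalSeq u v s t i : ZMod n)) := by
  have hinj : Set.InjOn (fun z : ℤ => (z : ZMod n)) (Icc (-(s : ℤ)) (t + 1)) := by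
    intro x hx y hy hxy
    rw [mem_coe, mem_Icc] at hx hy
    have hd := (ZMod.intCast_eq_intCast_iff_dvd_sub _ _ _).1 hxy
    have := Int.eq_zero_of_abs_lt_dvd hd (by rw [abs_lt]; omega)
    omega
  have hcard := card_image_of_injOn hinj
  rw [Int.card_Icc] at hcard
  have hsub : (Icc (-(s : ℤ)) (t + 1)).image (fun z : ℤ => (z : ZMod n)) ⊆
      univ.image fun i => (extremalSeq u v s t i : ZMod n) := by
    intro y hy
    obtain ⟨z, hz, rfl⟩ := mem_image.1 hy
    obtain ⟨i, hi⟩ := exists_extremalSeq_eq hu hv z hz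
    exact mem_image.2 ⟨i, mem_univ _, by simp [hi]⟩
  have := card_le_card hsub
  omega

/-- One long example excludes all shorter lengths: keep indices carrying `k` distinct values and
enlarge to `m` indices. -/
theorem not_mem_gLengths_of_not_zero_sum {ι : Type*} [Fintype ι] {n k m : ℕ} (b : ι → ZMod n)
    (hk : k ≤ #(univ.image b)) (hb : ∀ I : Finset ι, #I = n → ∑ i ∈ I, b i ≠ 0)
    (hm : m ≤ Fintype.card ι) : m ∉ gLengths n k := by
  classical
  rintro ⟨hkm, hall⟩
  obtain ⟨B, hB, hBk⟩ := exists_subset_card_eq hk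
  have hex : ∀ y : B, ∃ i, b i = y := fun y => by simpa using hB y.2
  choose c hc using hex
  have hK : #(univ.image c) ≤ k := card_image_le.trans (by simp [hBk])
  obtain ⟨J, hKJ, -, hJ⟩ := exists_subsuperset_card_eq (subset_univ (univ.image c))
    (hK.trans hkm) (by simpa using hm)
  set e := J.equivFinOfCardEq hJ
  obtain ⟨I, hI, hI0⟩ := hall (fun i => b (e.symm i)) (by
    rw [← hBk]
    refine card_le_card fun y hy => mem_image.2
      ⟨e ⟨c ⟨y, hy⟩, hKJ (mem_image_of_mem _ (mem_univ _))⟩, mem_univ _, ?_⟩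
    simp [hc])
  refine hb (I.map (e.symm.toEmbedding.trans (Function.Embedding.subtype _))) (by simpa using hI) ?_
  simpa using hI0

end LowerBound

/-! ### The value of `g(n,k)`. -/

theorem theorem5p1 (n k : ℕ) (hkn : k ≤ n) (hk : 4 ≤ k)
    (hkr : (k : ℝ) ≤ √(2 * (n : ℝ) - 1) + 1) :
    IsLeast (gLengths n k) (gFun n k) ∧
      (gFun n k : ℤ) = 2 * (n : ℤ) - 1 - ⌊(((k : ℝ) - 1) / 2) ^ 2⌋ := by
  have hsq : (k - 1) * (k - 1) + 1 ≤ 2 * n := by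
    have h1 : ((k : ℝ) - 1) ^ 2 ≤ 2 * n - 1 := by
      have hn : (1 : ℝ) ≤ n := by exact_mod_cast (by omega : 1 ≤ n)
      have hk1 : (1 : ℝ) ≤ k := by exact_mod_cast (by omega : 1 ≤ k)
      exact (Real.le_sqrt (by linarith) (by linarith)).1 (by linarith)
    zify [show 1 ≤ k by omega]
    have h2 : ((k : ℝ) - 1) * (k - 1) + 1 ≤ 2 * n := by linarith
    exact_mod_cast h2
  -- The balanced split minimises the two triangular numbers, whose sum `f` is the floor in the
  -- formula.
  obtain ⟨s, t, hst, hts⟩ : ∃ s t : ℕ, k = s + t + 2 ∧ (t = s ∨ t = s + 1) :=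
    ⟨(k - 2) / 2, (k - 1) / 2, by omega, by omega⟩
  obtain ⟨f, hf⟩ : ∃ f, s * (s + 1) + t * (t + 1) = 2 * f := by
    obtain ⟨x, hx⟩ := Nat.even_mul_succ_self s
    obtain ⟨y, hy⟩ := Nat.even_mul_succ_self t
    exact ⟨x + y, by omega⟩
  have hfsq : 4 * f ≤ (k - 1) * (k - 1) ∧ (k - 1) * (k - 1) ≤ 4 * f + 1 := by
    rw [hst, show s + t + 2 - 1 = s + t + 1 by omega]
    rcases hts with rfl | rfl <;> constructor <;> nlinarith
  have hfloor : ⌊(((k : ℝ) - 1) / 2) ^ 2⌋ = f := by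
    have h1 : 4 * (f : ℝ) ≤ (k - 1) * (k - 1) := by
      have := hfsq.1
      zify [show 1 ≤ k by omega] at this
      exact_mod_cast this
    have h2 : ((k : ℝ) - 1) * (k - 1) ≤ 4 * f + 1 := by
      have := hfsq.2
      zify [show 1 ≤ k by omega] at this
      exact_mod_cast this
    rw [Int.floor_eq_iff]
    push_cast
    constructor <;> nlinarith
  have hleast : IsLeast (gLengths n k) (2 * n - 1 - f) := by
    refine ⟨⟨by omega, fun a hka => ?_⟩, fun m hm => ?_⟩
    · by_contra hno
      -- Here `n < 2 * l` amounts to `2 * f < n`, which follows from `4 * f ≤ (k - 1)² ≤ 2 * n - 1`.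
      obtain ⟨s', t', h1, h2⟩ := card_image_le_of_not_hasNTermZeroSum (l := n - f) (by omega) a hno
        (by omega) (by omega)
      have h3 : s' * (s' + 1) + t' * (t' + 1) + 2 ≤ 2 * f := by omega
      have h4 : k - 1 ≤ s' + t' + 1 := by omega
      have h5 := Nat.mul_le_mul h4 h4
      zify at *
      nlinarith [sq_nonneg ((s' : ℤ) - t')]
    · by_contra! hlt
      obtain ⟨x, hx⟩ := Nat.even_mul_succ_self s
      obtain ⟨y, hy⟩ := Nat.even_mul_succ_self t
      have hs : 1 ≤ s := by omega
      rw [hst, show s + t + 2 - 1 = s + t + 1 by omega] at hsq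
      have hus : s + x + 2 ≤ n := by rcases hts with rfl | rfl <;> nlinarith
      have hvt : t + y + 2 ≤ n := by rcases hts with rfl | rfl <;> nlinarith
      -- The numbers of zeros and ones make both extreme sums tight; the total length is `2 * n - 2
      -- - f`.
      refine not_mem_gLengths_of_not_zero_sum
        (fun i => (extremalSeq (n - 1 - s - x) (n - 1 - t - y) s t i : ZMod n)) ?_ ?_ ?_ hm
      · rw [hst]
        exact le_card_image_extremalSeq (by omega) (by omega) (by omega)
      · intro I hI h0
        have h1 := sum_extremalSeq_pos (n := n) (by omega) I hI
        have h2 := sum_extremalSeq_lt (n := n) (by omega) I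
        rw [← Int.cast_sum, ZMod.intCast_zmod_eq_zero_iff_dvd] at h0
        have := Int.le_of_dvd h1 h0
        omega
      · simp only [Fintype.card_sum, Fintype.card_fin]
        omega
  have hg : gFun n k = 2 * n - 1 - f := hleast.csInf_eq
  rw [hg, hfloor]
  exact ⟨hleast, by omega⟩
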